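/- Consider a $K$ user ADT deterministic interference network with channel strength levels $n_{ki}\in\{0,1,2,\ldots\}$ from Transmitter $i$ to Receiver $k$: in every channel use Transmitter $i$ sends a real number $X_i\in[0,1)$, and Receiver $k$ observes $Y_k=\lfloor 2^{n_{k1}}X_1\rfloor\oplus\cdots\oplus\lfloor 2^{n_{kK}}X_K\rfloor$, where $\oplus$ is the bitwise sum modulo two of binary expansions. Each Transmitter $i$ has an independent message, uniform on a set of $\lceil 2^{NR_i}\rceil$ elements, to be decoded by Receiver $i$ after $N$ channel uses; a tuple $(R_1,\ldots,R_K)\in\mathbb{R}^K_+$ is achievable if there are codes whose error probability at each receiver tends to $0$ as $N\to\infty$, and the capacity region $\mathcal{C}$ is the closure of the set of achievable tuples. Power control and treating interference as noise (TIN) is the following scheme. In a time slot with power back-offs $r=(r_1,\ldots,r_K)$, $r_i\in\{0,1,2,\ldots\}$, the inputs are independent, $X_i$ is uniformly distributed on $[0,2^{-r_i})$ (to the finest resolution visible to any receiver), and user $k$ has the rate $I_r(X_k;Y_k)$ in bits. The back-offs may vary over a finite number of time slots, and the TIN region $\mathcal{R}_{\mathrm{TIN}}$ is the closure of the set of all $(R_1,\ldots,R_K)\in\mathbb{R}^K_+$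 such that, for some $T\geq 1$ and some back-offs $r^{(1)},\ldots,r^{(T)}$, $R_k\leq\frac1T\sum_{t=1}^{T} I_{r^{(t)}}(X_k;Y_k)$ for all $k$. A cycle $\pi$ is a nonempty cyclically ordered set $(i_1,\ldots,i_L)$ of distinct users; its weight is $w(\pi)=n_{i_1i_2}+n_{i_2i_3}+\cdots+n_{i_Li_1}$ if $L\geq 2$, and $w(\pi)=0$ if $L=1$. Theorem. If $$n_{ii}\geq\max_{j:j\neq i}\{n_{ji}\}+\max_{k:k\neq i}\{n_{ik}\}\quad\text{for all } i\in\{1,\ldots,K\}$$ (a maximum over the empty set is $0$), then power control and treating interference as noise achieve the whole capacity region, $\mathcal{R}_{\mathrm{TIN}}=\mathcal{C}$. Moreover, $$\mathcal{C}=\Big\{(R_1,\ldots,R_K)\in\mathbb{R}^K_+ : \sum_{k\in\pi}R_k\leq\sum_{k\in\pi}n_{kk}-w(\pi)\ \text{ for every cycle } \pi\Big\}.$$ -/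

import Mathlib

/-! ### The ADT deterministic interference network

`n k i` is the channel strength level from transmitter `i` to receiver `k`. -/

namespace ADT

/-- The output of receiver `k` in one channel use: the bitwise sum modulo two (XOR) over all
transmitters `i` of `⌊2 ^ (n k i) * x i⌋`, where `x i` is the real input of transmitter `i`. -/
noncomputable def output {K : ℕ} (n : Fin K → Fin K → ℕ) (k : Fin K) (x : Fin K → ℝ) : ℕ :=
  Finset.univ.fold (fun a b : ℕ => a ^^^ b) 0 (fun i => ⌊(2 : ℝ) ^ (n k i) * x i⌋₊)

/-- A code of block length `N` with message sets `Fin (M i)`. An input symbol is a real number in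
`[0, 1)`, that is, a number with a binary expansion `0.b₁b₂b₃…`. -/
structure Code (K N : ℕ) (M : Fin K → ℕ) where
  enc : (i : Fin K) → Fin (M i) → Fin N → ℝ
  enc_mem : ∀ i w t, enc i w t ∈ Set.Ico (0 : ℝ) 1
  dec : (k : Fin K) → (Fin N → ℕ) → Fin (M k)

/-- The sequence received by receiver `k` when the messages are `w`. -/
noncomputable def Code.received {K N : ℕ} {M : Fin K → ℕ} (c : Code K N M)
    (n : Fin K → Fin K → ℕ) (w : (i : Fin K) → Fin (M i)) (k : Fin K) : Fin N → ℕ :=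
  fun t => output n k (fun i => c.enc i (w i) t)

/-- The probability that receiver `k` decodes its message wrongly, for independent messages,
each uniformly distributed. -/
noncomputable def Code.errorProb {K N : ℕ} {M : Fin K → ℕ} (c : Code K N M)
    (n : Fin K → Fin K → ℕ) (k : Fin K) : ℝ :=
  ((Finset.univ.filter
      (fun w : (i : Fin K) → Fin (M i) => c.dec k (c.received n w k) ≠ w k)).card : ℝ) /
    (Fintype.card ((i : Fin K) → Fin (M i)) : ℝ)

/-- The number `⌈2 ^ (N R)⌉` of messages at rate `R` (bits per channel use) and block length `N`. -/
noncomputable def numMessages (N : ℕ) (R : ℝ) : ℕ := ⌈(2 : ℝ) ^ ((N : ℝ) * R)⌉₊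

/-- A nonnegative rate tuple is achievable if there are codes of these rates, one for every block
length, whose error probability at each receiver tends to zero. -/
def Achievable {K : ℕ} (n : Fin K → Fin K → ℕ) (R : Fin K → ℝ) : Prop :=
  (∀ k, 0 ≤ R k) ∧
    ∃ c : (N : ℕ) → Code K N (fun i => numMessages N (R i)),
      ∀ k, Filter.Tendsto (fun N => (c N).errorProb n k) Filter.atTop (nhds 0)

/-- The capacity region: the closure of the set of achievable rate tuples. -/
def capacityRegion {K : ℕ} (n : Fin K → Fin K → ℕ) : Set (Fin K → ℝ) :=
  closure {R | Achievable n R}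

/-! ### Power control and treating interference as noise -/

/-- Shannon entropy, in bits, of the random variable `X` on the finite sample space `Ω` with the
uniform distribution. -/
noncomputable def entropy {Ω α : Type} [Fintype Ω] [DecidableEq α] (X : Ω → α) : ℝ :=
  ∑ a ∈ Finset.univ.image X,
    Real.negMulLog
      (((Finset.univ.filter (fun ω => X ω = a)).card : ℝ) / (Fintype.card Ω : ℝ)) / Real.log 2

/-- Mutual information `I(X; Y) = H(X) + H(Y) - H(X, Y)`, in bits. -/
noncomputable def mutualInfo {Ω α β : Type} [Fintype Ω] [DecidableEq α] [DecidableEq β]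
    (X : Ω → α) (Y : Ω → β) : ℝ :=
  entropy X + entropy Y - entropy (fun ω => (X ω, Y ω))

/-- The largest channel strength level of the network: it bounds the number of bits of an
input that any receiver can see. -/
def maxLevel {K : ℕ} (n : Fin K → Fin K → ℕ) : ℕ :=
  Finset.univ.sup (fun k => Finset.univ.sup (fun i => n k i))

/-- The sample space of the inputs: each user independently draws `L` fair bits,
written as an integer below `2 ^ L`. -/
abbrev Bits (K L : ℕ) : Type := Fin K → Fin (2 ^ L)

/-- The input of user `i` under the power back-off `r i`: the number `0.b₁b₂…b_L` made of its
fair bits, scaled by `2 ^ (-r i)`, so that it is uniform (to the resolution visible to the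
receivers if `L ≥ maxLevel n`) on `[0, 2 ^ (-r i))`: the top `r i` signal levels are silent. -/
noncomputable def tinInput {K : ℕ} (L : ℕ) (r : Fin K → ℕ) (i : Fin K) (ω : Bits K L) : ℝ :=
  ((ω i : ℕ) : ℝ) / 2 ^ (L + r i)

/-- The rate `I(X_k; Y_k)` of user `k` when the users employ the power back-offs `r` and receiver
`k` treats the signals of all other users as noise. -/
noncomputable def tinRate {K : ℕ} (n : Fin K → Fin K → ℕ) (r : Fin K → ℕ) (k : Fin K) : ℝ :=
  mutualInfo (fun ω : Bits K (maxLevel n) => tinInput (maxLevel n) r k ω)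
    (fun ω => output n k (fun i => tinInput (maxLevel n) r i ω))

/-- A nonnegative rate tuple is supported by power control and treating interference as noise if,
for some number `T ≥ 1` of time slots and power back-offs `r t i` of user `i` in slot `t`,
the rate of every user is at most its average rate over the slots. -/
def TINSupported {K : ℕ} (n : Fin K → Fin K → ℕ) (R : Fin K → ℝ) : Prop :=
  (∀ k, 0 ≤ R k) ∧
    ∃ (T : ℕ) (_ : 0 < T) (r : Fin T → Fin K → ℕ),
      ∀ k, R k ≤ (∑ t, tinRate n (r t) k) / (T : ℝ)

/-- The region achieved by power control and treating interference as noise. -/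
def tinRegion {K : ℕ} (n : Fin K → Fin K → ℕ) : Set (Fin K → ℝ) :=
  closure {R | TINSupported n R}

/-! ### Cycles and the cycle bounds -/

/-- A cycle: a nonempty cyclically ordered set of users without repetitions, listed from one of
its users as `vertex 0, …, vertex len`. It has `len + 1` users; `len = 0` is a trivial cycle. -/
structure UserCycle (K : ℕ) where
  len : ℕ
  vertex : Fin (len + 1) → Fin K
  injective : Function.Injective vertex

/-- The weight of the edge `e i j` (from user `j` to user `i`). -/
def edgeWeight {K : ℕ} (n : Fin K → Fin K → ℕ) (i j : Fin K) : ℕ :=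
  if i = j then 0 else n i j

/-- The weight of a cycle: the sum of the weights of its edges (the index `l + 1` is cyclic). -/
def UserCycle.weight {K : ℕ} (n : Fin K → Fin K → ℕ) (p : UserCycle K) : ℕ :=
  ∑ l, edgeWeight n (p.vertex l) (p.vertex (l + 1))

/-- The polyhedron of nonnegative rate tuples that satisfy all cycle bounds. -/
def cycleRegion {K : ℕ} (n : Fin K → Fin K → ℕ) : Set (Fin K → ℝ) :=
  {R | (∀ k, 0 ≤ R k) ∧
    ∀ p : UserCycle K,
      ∑ l, R (p.vertex l) ≤
        ∑ l, (n (p.vertex l) (p.vertex l) : ℝ) - (p.weight n : ℝ)}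

/-- The condition `n i i ≥ max_{j ≠ i} n j i + max_{k ≠ i} n i k` for all users `i`
(the maximum over the empty set is `0`, which matters only for one user). -/
def TINCondition {K : ℕ} (n : Fin K → Fin K → ℕ) : Prop :=
  ∀ i, (Finset.univ.erase i).sup (fun j => n j i) + (Finset.univ.erase i).sup (fun k => n i k)
    ≤ n i i

end ADT

/-! Both regions are shown to equal `cycleRegion n`. Achievability: in the complete digraph in which
the edge from `k` to `j` has length `n k k - R k - n k j`, the cycle bounds for nontrivial cycles
say that no cycle has negative length. Shortest-path values therefore exist and serve as real
back-offs `r` (`exists_potential`): after back-off, the `R k` levels that user `k` occupies at its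
receiver lie above all interference. Rounding `r k` and `r k + R k` with the offsets `t / T` over
`T` slots gives integer back-offs and level counts whose average loses at most `1 / T`
(`exists_slots`). The levels above the interference are a function of both `X_k` and `Y_k`, which
bounds the TIN rate from below (`le_tinRate`); uncoded bits on them give zero-error codes, one slot
per channel use (`exists_code_errorProb_eq_zero`). Converse: for users `i`, `k`, `j` consecutive on
a cycle, let `S` be what `k` causes at `i` and `A` what `j` causes at `k`. A genie argument gives
`I(W_k; Y_k) ≤ H(S) + N (n k k - edgeWeight n i k) - H(A)` (`mutualInfo_receivedSeq_le`). Around the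
cycle the entropies cancel, leaving the cycle bound. Fano's inequality transfers it to codes; a TIN
slot is the case `N = 1`. -/

namespace ADT

/-! ### Entropy on a finite uniform probability space -/

section Entropy

variable {Ω α β γ : Type} [Fintype Ω] [DecidableEq α] [DecidableEq β] [DecidableEq γ]

/-- The number of sample points on which `X` takes the value `a`. -/
def fiberCard (X : Ω → α) (a : α) : ℕ := (Finset.univ.filter (fun ω => X ω = a)).card

theorem fiberCard_pos (X : Ω → α) (ω : Ω) : 0 < fiberCard X (X ω) :=
  Finset.card_pos.mpr ⟨ω, by simp⟩

theorem sum_div_fiberCard (X : Ω → α) (f : α → ℝ) :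
    ∑ ω, f (X ω) / fiberCard X (X ω) = ∑ a ∈ Finset.univ.image X, f a := by
  rw [Finset.sum_comp (fun a => f a / fiberCard X a) X]
  refine Finset.sum_congr rfl fun a ha => ?_
  obtain ⟨ω, -, rfl⟩ := Finset.mem_image.mp ha
  have h : (0 : ℝ) < fiberCard X (X ω) := by exact_mod_cast fiberCard_pos X ω
  rw [nsmul_eq_mul, ← fiberCard]
  field_simp

theorem sum_fiberCard (X : Ω → α) {s : Finset α} (hs : ∀ ω, X ω ∈ s) :
    ∑ a ∈ s, fiberCard X a = Fintype.card Ω :=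
  (Finset.card_eq_sum_card_fiberwise fun ω _ => hs ω).symm

theorem sum_fiberCard_pair (X : Ω → α) (Z : Ω → γ) (z : γ) :
    ∑ a ∈ Finset.univ.image X, fiberCard (fun ω => (X ω, Z ω)) (a, z) = fiberCard Z z := by
  rw [fiberCard, Finset.card_eq_sum_card_fiberwise (f := X) (t := Finset.univ.image X)
    (fun ω _ => by simp)]
  refine Finset.sum_congr rfl fun a _ => ?_
  rw [fiberCard, Finset.filter_filter]
  congr 1
  ext ω
  simp [and_comm]

variable [Nonempty Ω]

/-- Averaging over sample points instead of values turns comparisons of entropies into pointwise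
comparisons of fibre sizes. -/
theorem entropy_eq (X : Ω → α) :
    entropy X = Real.logb 2 (Fintype.card Ω) -
      (∑ ω, Real.logb 2 (fiberCard X (X ω))) / Fintype.card Ω := by
  have hΩ : (0 : ℝ) < Fintype.card Ω := by exact_mod_cast Fintype.card_pos
  have h1 : ∑ ω, Real.logb 2 (fiberCard X (X ω)) =
      ∑ a ∈ Finset.univ.image X, (fiberCard X a : ℝ) * Real.logb 2 (fiberCard X a) := by
    rw [Finset.sum_comp (fun a => Real.logb 2 (fiberCard X a)) X]
    simp only [nsmul_eq_mul]
    rfl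
  have h2 : Real.logb 2 (Fintype.card Ω) =
      (∑ a ∈ Finset.univ.image X, (fiberCard X a : ℝ) * Real.logb 2 (Fintype.card Ω)) /
        Fintype.card Ω := by
    rw [← Finset.sum_mul, ← Nat.cast_sum, sum_fiberCard X (by simp)]
    field_simp
  rw [h1, h2, ← sub_div, ← Finset.sum_sub_distrib, Finset.sum_div, entropy]
  refine Finset.sum_congr rfl fun a ha => ?_
  obtain ⟨ω, -, rfl⟩ := Finset.mem_image.mp ha
  have h : (0 : ℝ) < fiberCard X (X ω) := by exact_mod_cast fiberCard_pos X ω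
  change Real.negMulLog ((fiberCard X (X ω) : ℝ) / _) / _ = _
  rw [Real.negMulLog, Real.log_div h.ne' hΩ.ne', Real.logb, Real.logb]
  ring

/-- Gibbs' inequality. -/
theorem entropy_le_cross (X : Ω → α) (q : α → ℝ) (hq : ∀ ω, 0 < q (X ω))
    (hs : ∑ a ∈ Finset.univ.image X, q a ≤ 1) :
    entropy X ≤ -(∑ ω, Real.logb 2 (q (X ω))) / Fintype.card Ω := by
  have hΩ : (0 : ℝ) < Fintype.card Ω := by exact_mod_cast Fintype.card_pos
  have hl : 0 < Real.log 2 := Real.log_pos (by norm_num)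
  -- The argument of the logarithm is the likelihood ratio `q / p`, with `p` the law of `X`; `log y
  -- ≤ y - 1` is summed.
  have key : ∑ ω, Real.log (Fintype.card Ω * (q (X ω) / fiberCard X (X ω))) ≤ 0 := by
    calc ∑ ω, Real.log (Fintype.card Ω * (q (X ω) / fiberCard X (X ω)))
        ≤ ∑ ω, (Fintype.card Ω * (q (X ω) / fiberCard X (X ω)) - 1) := by
          refine Finset.sum_le_sum fun ω _ => Real.log_le_sub_one_of_pos ?_
          have h : (0 : ℝ) < fiberCard X (X ω) := by exact_mod_cast fiberCard_pos X ω
          have := hq ω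
          positivity
      _ = Fintype.card Ω * (∑ a ∈ Finset.univ.image X, q a - 1) := by
          rw [Finset.sum_sub_distrib, ← Finset.mul_sum, sum_div_fiberCard]
          simp
          ring
      _ ≤ 0 := mul_nonpos_of_nonneg_of_nonpos hΩ.le (by linarith)
  have key2 : ∑ ω, Real.log (Fintype.card Ω * (q (X ω) / fiberCard X (X ω))) =
      (Real.logb 2 (Fintype.card Ω) * Fintype.card Ω + ∑ ω, Real.logb 2 (q (X ω)) -
        ∑ ω, Real.logb 2 (fiberCard X (X ω))) * Real.log 2 := by
    have : ∀ ω, Real.log (Fintype.card Ω * (q (X ω) / fiberCard X (X ω))) =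
        (Real.logb 2 (Fintype.card Ω) + Real.logb 2 (q (X ω)) -
          Real.logb 2 (fiberCard X (X ω))) * Real.log 2 := by
      intro ω
      have h : (0 : ℝ) < fiberCard X (X ω) := by exact_mod_cast fiberCard_pos X ω
      have := hq ω
      rw [Real.log_mul hΩ.ne' (by positivity), Real.log_div this.ne' h.ne']
      simp only [Real.logb]
      field_simp
      ring
    simp only [this]
    rw [← Finset.sum_mul, Finset.sum_sub_distrib, Finset.sum_add_distrib]
    simp
    ring_nf
    simp
  rw [key2] at key
  have key3 := nonpos_of_mul_nonpos_left key hl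
  rw [entropy_eq, le_div_iff₀ hΩ, sub_mul, div_mul_cancel₀ _ hΩ.ne']
  linarith

theorem entropy_le_logb_card (X : Ω → α) {s : Finset α} (hs : ∀ ω, X ω ∈ s) :
    entropy X ≤ Real.logb 2 s.card := by
  have hΩ : (0 : ℝ) < Fintype.card Ω := by exact_mod_cast Fintype.card_pos
  have hc : (0 : ℝ) < s.card := by
    exact_mod_cast Finset.card_pos.mpr ⟨_, hs (Classical.arbitrary Ω)⟩
  refine (entropy_le_cross X (fun _ => (s.card : ℝ)⁻¹) (fun _ => by positivity) ?_).trans ?_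
  · rw [Finset.sum_const, nsmul_eq_mul, ← div_eq_mul_inv, div_le_one hc]
    exact_mod_cast Finset.card_le_card (Finset.image_subset_iff.mpr fun ω _ => hs ω)
  · simp [Real.logb_inv]

/-- No value of `X` has probability above `1 / M`, so the surprisal is at least `log M` everywhere.
-/
theorem logb_le_entropy (X : Ω → α) {M : ℝ} (hM : 0 < M)
    (h : ∀ ω, (fiberCard X (X ω) : ℝ) * M ≤ Fintype.card Ω) :
    Real.logb 2 M ≤ entropy X := by
  have hΩ : (0 : ℝ) < Fintype.card Ω := by exact_mod_cast Fintype.card_pos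
  have h1 : ∑ ω, Real.logb 2 (fiberCard X (X ω)) ≤
      ∑ _ω : Ω, (Real.logb 2 (Fintype.card Ω) - Real.logb 2 M) := by
    refine Finset.sum_le_sum fun ω _ => ?_
    have hf : (0 : ℝ) < fiberCard X (X ω) := by exact_mod_cast fiberCard_pos X ω
    rw [le_sub_iff_add_le, ← Real.logb_mul hf.ne' hM.ne']
    exact Real.logb_le_logb_of_le (by norm_num) (by positivity) (h ω)
  rw [Finset.sum_const, nsmul_eq_mul, Finset.card_univ] at h1
  have h2 := (div_le_iff₀' hΩ).mpr h1
  rw [entropy_eq]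
  linarith

theorem entropy_nonneg (X : Ω → α) : 0 ≤ entropy X := by
  simpa using logb_le_entropy X one_pos fun ω => by
    rw [mul_one]
    exact_mod_cast Finset.card_le_univ _

/-- Entropy is monotone: a function of a random variable has at most its entropy. -/
theorem entropy_mono {X : Ω → α} {Y : Ω → β} (h : ∀ ω ω', X ω = X ω' → Y ω = Y ω') :
    entropy Y ≤ entropy X := by
  rw [entropy_eq, entropy_eq]
  gcongr with ω
  · norm_num
  · exact_mod_cast fiberCard_pos X ω
  · exact Finset.card_le_card fun ω' => by simpa using h ω' ω

theorem entropy_congr {X : Ω → α} {Y : Ω → β} (h : ∀ ω ω', X ω = X ω' ↔ Y ω = Y ω') :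
    entropy X = entropy Y :=
  le_antisymm (entropy_mono fun ω ω' => (h ω ω').mpr) (entropy_mono fun ω ω' => (h ω ω').mp)

/-- Gibbs' inequality for the law `p(x, z) p(y, z) / p(z)`, under which `X` and `Y` are
conditionally independent given `Z`. -/
theorem entropy_submodular (X : Ω → α) (Y : Ω → β) (Z : Ω → γ) :
    entropy (fun ω => (X ω, Y ω, Z ω)) + entropy Z ≤
      entropy (fun ω => (X ω, Z ω)) + entropy (fun ω => (Y ω, Z ω)) := by
  have hΩ : (0 : ℝ) < Fintype.card Ω := by exact_mod_cast Fintype.card_pos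
  set XZ := fun ω => (X ω, Z ω) with hXZ
  set YZ := fun ω => (Y ω, Z ω) with hYZ
  set W := fun ω => (X ω, Y ω, Z ω) with hW
  let q : α × β × γ → ℝ := fun p =>
    (fiberCard XZ (p.1, p.2.2) : ℝ) * fiberCard YZ (p.2.1, p.2.2) /
      (fiberCard Z p.2.2 * Fintype.card Ω)
  have hx : ∀ ω, (0 : ℝ) < fiberCard XZ (X ω, Z ω) := fun ω => by
    exact_mod_cast fiberCard_pos XZ ω
  have hy : ∀ ω, (0 : ℝ) < fiberCard YZ (Y ω, Z ω) := fun ω => by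
    exact_mod_cast fiberCard_pos YZ ω
  have hz : ∀ ω, (0 : ℝ) < fiberCard Z (Z ω) := fun ω => by
    exact_mod_cast fiberCard_pos Z ω
  have hq : ∀ ω, 0 < q (W ω) := fun ω => by
    have := hx ω
    have := hy ω
    have := hz ω
    simp only [q, W]
    positivity
  have hsum : ∑ p ∈ Finset.univ.image W, q p ≤ 1 := by
    have hsub : Finset.univ.image W ⊆
        Finset.univ.image X ×ˢ (Finset.univ.image Y ×ˢ Finset.univ.image Z) := by
      intro p hp
      obtain ⟨ω, -, rfl⟩ := Finset.mem_image.mp hp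
      simp [W]
    refine (Finset.sum_le_sum_of_subset_of_nonneg hsub fun p _ _ => by positivity).trans ?_
    rw [Finset.sum_product_right' (f := fun a b => q (a, b)), Finset.sum_product_right]
    have inner : ∀ z ∈ Finset.univ.image Z,
        ∑ y ∈ Finset.univ.image Y, ∑ x ∈ Finset.univ.image X, q (x, y, z) =
          (fiberCard Z z : ℝ) / Fintype.card Ω := by
      intro z hz'
      obtain ⟨ω, -, rfl⟩ := Finset.mem_image.mp hz'
      have := hz ω
      simp only [q, ← Finset.sum_div, ← Finset.sum_mul, ← Finset.mul_sum]
      rw [← Nat.cast_sum, ← Nat.cast_sum, sum_fiberCard_pair, sum_fiberCard_pair]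
      field_simp
    rw [Finset.sum_congr rfl inner, ← Finset.sum_div, ← Nat.cast_sum,
      sum_fiberCard Z (by simp), div_self hΩ.ne']
  have hg := entropy_le_cross W q hq hsum
  have hlog : ∑ ω, Real.logb 2 (q (W ω)) =
      ∑ ω, Real.logb 2 (fiberCard XZ (X ω, Z ω)) + ∑ ω, Real.logb 2 (fiberCard YZ (Y ω, Z ω)) -
        ∑ ω, Real.logb 2 (fiberCard Z (Z ω)) - Fintype.card Ω * Real.logb 2 (Fintype.card Ω) := by
    have : ∀ ω, Real.logb 2 (q (W ω)) = Real.logb 2 (fiberCard XZ (X ω, Z ω)) +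
        Real.logb 2 (fiberCard YZ (Y ω, Z ω)) - Real.logb 2 (fiberCard Z (Z ω)) -
          Real.logb 2 (Fintype.card Ω) := by
      intro ω
      have h1 := (hx ω).ne'
      have h2 := (hy ω).ne'
      have h3 := (hz ω).ne'
      simp only [q, W]
      rw [Real.logb_div (mul_ne_zero h1 h2) (mul_ne_zero h3 hΩ.ne'), Real.logb_mul h1 h2,
        Real.logb_mul h3 hΩ.ne']
      ring
    simp only [this, Finset.sum_sub_distrib, Finset.sum_add_distrib]
    simp
  rw [hlog] at hg
  rw [entropy_eq Z, entropy_eq XZ, entropy_eq YZ]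
  have e : -(∑ ω, Real.logb 2 (fiberCard XZ (X ω, Z ω)) +
      ∑ ω, Real.logb 2 (fiberCard YZ (Y ω, Z ω)) - ∑ ω, Real.logb 2 (fiberCard Z (Z ω)) -
      Fintype.card Ω * Real.logb 2 (Fintype.card Ω)) / (Fintype.card Ω : ℝ) =
      -(∑ ω, Real.logb 2 (fiberCard XZ (X ω, Z ω))) / Fintype.card Ω -
      (∑ ω, Real.logb 2 (fiberCard YZ (Y ω, Z ω))) / Fintype.card Ω +
      (∑ ω, Real.logb 2 (fiberCard Z (Z ω))) / Fintype.card Ω +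
      Real.logb 2 (Fintype.card Ω) := by
    field_simp
    ring
  rw [e] at hg
  simp only [hXZ, hYZ] at hg ⊢
  rw [neg_div] at hg
  linarith

theorem entropy_pair_le (X : Ω → α) (Y : Ω → β) :
    entropy (fun ω => (X ω, Y ω)) ≤ entropy X + entropy Y := by
  have h := entropy_submodular X Y (fun _ => ())
  have h0 := entropy_nonneg (fun _ : Ω => ())
  have h1 : entropy (fun ω => (X ω, Y ω)) ≤ entropy (fun ω => (X ω, Y ω, ())) :=
    entropy_mono fun ω ω' => by simp
  have h2 : entropy (fun ω => (X ω, ())) ≤ entropy X := entropy_mono fun ω ω' => by simp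
  have h3 : entropy (fun ω => (Y ω, ())) ≤ entropy Y := entropy_mono fun ω ω' => by simp
  linarith

theorem entropy_pair_of_indep (X : Ω → α) (Y : Ω → β)
    (h : ∀ ω, fiberCard (fun ω => (X ω, Y ω)) (X ω, Y ω) * Fintype.card Ω =
      fiberCard X (X ω) * fiberCard Y (Y ω)) :
    entropy (fun ω => (X ω, Y ω)) = entropy X + entropy Y := by
  have hΩ : (0 : ℝ) < Fintype.card Ω := by exact_mod_cast Fintype.card_pos
  have key : ∑ ω, Real.logb 2 (fiberCard (fun ω => (X ω, Y ω)) (X ω, Y ω)) +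
      Fintype.card Ω * Real.logb 2 (Fintype.card Ω) =
      ∑ ω, Real.logb 2 (fiberCard X (X ω)) + ∑ ω, Real.logb 2 (fiberCard Y (Y ω)) := by
    have : ∀ ω, Real.logb 2 (fiberCard (fun ω => (X ω, Y ω)) (X ω, Y ω)) +
        Real.logb 2 (Fintype.card Ω) =
        Real.logb 2 (fiberCard X (X ω)) + Real.logb 2 (fiberCard Y (Y ω)) := by
      intro ω
      have h1 : (fiberCard (fun ω => (X ω, Y ω)) (X ω, Y ω) : ℝ) ≠ 0 := by
        exact_mod_cast (fiberCard_pos (fun ω => (X ω, Y ω)) ω).ne'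
      have h2 : (fiberCard X (X ω) : ℝ) ≠ 0 := by exact_mod_cast (fiberCard_pos X ω).ne'
      have h3 : (fiberCard Y (Y ω) : ℝ) ≠ 0 := by exact_mod_cast (fiberCard_pos Y ω).ne'
      rw [← Real.logb_mul h1 hΩ.ne', ← Real.logb_mul h2 h3]
      exact_mod_cast congrArg (fun m : ℕ => Real.logb 2 (m : ℝ)) (h ω)
    rw [← Finset.sum_add_distrib, ← Finset.sum_congr rfl fun ω _ => this ω,
      Finset.sum_add_distrib]
    simp
  rw [entropy_eq, entropy_eq X, entropy_eq Y]
  field_simp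
  linarith

/-- Submodularity applied to a common function `Z` of `X` and `Y`; `Z` will be the bits that can be
read off above the interference. -/
theorem entropy_le_mutualInfo {X : Ω → α} {Y : Ω → β} {Z : Ω → γ}
    (hX : ∀ ω ω', X ω = X ω' → Z ω = Z ω') (hY : ∀ ω ω', Y ω = Y ω' → Z ω = Z ω') :
    entropy Z ≤ mutualInfo X Y := by
  have h := entropy_submodular X Y Z
  have h1 : entropy (fun ω => (X ω, Y ω)) ≤ entropy (fun ω => (X ω, Y ω, Z ω)) :=
    entropy_mono fun ω ω' => by simp +contextual
  have h2 : entropy (fun ω => (X ω, Z ω)) ≤ entropy X :=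
    entropy_mono fun ω ω' e => by simp [e, hX _ _ e]
  have h3 : entropy (fun ω => (Y ω, Z ω)) ≤ entropy Y :=
    entropy_mono fun ω ω' e => by simp [e, hY _ _ e]
  rw [mutualInfo]
  linarith

theorem mutualInfo_le (X : Ω → α) {Y : Ω → β} {Z : Ω → γ}
    (h : ∀ ω ω', X ω = X ω' → Y ω = Y ω' → Z ω = Z ω') :
    mutualInfo X Y ≤ entropy X + entropy Y - entropy Z := by
  have := entropy_mono (X := fun ω => (X ω, Y ω)) (Y := Z) fun ω ω' e =>
    h ω ω' (Prod.mk.inj e).1 (Prod.mk.inj e).2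
  rw [mutualInfo]
  linarith

/-- The data processing inequality. -/
theorem mutualInfo_mono_right (X : Ω → α) {Y : Ω → β} {Z : Ω → γ}
    (h : ∀ ω ω', Y ω = Y ω' → Z ω = Z ω') : mutualInfo X Z ≤ mutualInfo X Y := by
  have h0 := entropy_submodular X Y Z
  have h1 : entropy (fun ω => (X ω, Y ω)) ≤ entropy (fun ω => (X ω, Y ω, Z ω)) :=
    entropy_mono fun ω ω' => by simp +contextual
  have h2 : entropy (fun ω => (Y ω, Z ω)) ≤ entropy Y :=
    entropy_mono fun ω ω' e => by simp [e, h _ _ e]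
  rw [mutualInfo, mutualInfo]
  linarith

theorem mutualInfo_congr {δ : Type} [DecidableEq δ] {X : Ω → α} {X' : Ω → β} {Y : Ω → γ}
    {Y' : Ω → δ} (hX : ∀ ω ω', X ω = X ω' ↔ X' ω = X' ω')
    (hY : ∀ ω ω', Y ω = Y ω' ↔ Y' ω = Y' ω') : mutualInfo X Y = mutualInfo X' Y' := by
  rw [mutualInfo, mutualInfo, entropy_congr hX, entropy_congr hY]
  congr 1
  exact entropy_congr fun ω ω' => by simp [hX ω ω', hY ω ω']

/-- Fano's inequality. -/
theorem entropy_sub_le_mutualInfo_of_decoder {M : ℕ} (W : Ω → Fin M) (Y : Ω → β)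
    (g : β → Fin M) :
    entropy W - 1 - (Finset.univ.filter fun ω => g (Y ω) ≠ W ω).card / (Fintype.card Ω : ℝ) *
      Real.logb 2 M ≤ mutualInfo W Y := by
  have hΩ : (0 : ℝ) < Fintype.card Ω := by exact_mod_cast Fintype.card_pos
  have hM : (0 : ℝ) < M := by
    exact_mod_cast (Nat.zero_le _).trans_lt (W (Classical.arbitrary Ω)).isLt
  -- `V` is the correction that recovers `W` from `Y`. Its entropy is bounded by Gibbs with mass `1
  -- / 2` on "no error" and the other half spread evenly over the `M` messages.
  let V : Ω → Option (Fin M) := fun ω => if g (Y ω) = W ω then none else some (W ω)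
  let q : Option (Fin M) → ℝ := fun v => v.elim (1 / 2) (fun _ => 1 / (2 * M))
  have hq : ∀ v, 0 < q v := by
    rintro (_ | _) <;> simp only [q, Option.elim] <;> positivity
  have h1 : entropy V ≤ 1 + (Finset.univ.filter fun ω => g (Y ω) ≠ W ω).card /
      (Fintype.card Ω : ℝ) * Real.logb 2 M := by
    refine (entropy_le_cross V q (fun ω => hq _) ?_).trans_eq ?_
    · refine (Finset.sum_le_univ_sum_of_nonneg fun v => (hq v).le).trans_eq ?_
      rw [Fintype.sum_option]
      simp [q]
      field_simp
      norm_num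
    · have : ∀ ω, Real.logb 2 (q (V ω)) =
          -(1 + if g (Y ω) ≠ W ω then Real.logb 2 M else 0) := by
        intro ω
        by_cases e : g (Y ω) = W ω
        · simp [V, q, e, Real.logb_inv]
        · simp [V, q, e, Real.logb_inv, Real.logb_mul, hM.ne']
      simp only [this, Finset.sum_neg_distrib, Finset.sum_add_distrib, ← Finset.sum_filter]
      simp
      field_simp
  have h2 : entropy (fun ω => (W ω, Y ω)) ≤ entropy (fun ω => (V ω, Y ω)) := by
    refine entropy_mono fun ω ω' e => ?_
    obtain ⟨e1, e2⟩ := Prod.mk.inj e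
    refine Prod.ext ?_ e2
    simp only [V, e2] at e1
    by_cases a : g (Y ω') = W ω <;> by_cases b : g (Y ω') = W ω' <;> simp_all
  have h3 := entropy_pair_le V Y
  rw [mutualInfo]
  linarith

end Entropy

/-! ### Independence of coordinates on a product space -/

section Product

variable {ι : Type} [Fintype ι] [DecidableEq ι] {Ω : ι → Type} [∀ i, Fintype (Ω i)]
  {α β : Type} [DecidableEq α] [DecidableEq β]

/-- A function of one coordinate is independent of a function of the other coordinates. -/
theorem entropy_pair_of_coordinate [∀ i, Nonempty (Ω i)] (i : ι) (X : (∀ i, Ω i) → α)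
    (Y : (∀ i, Ω i) → β) (hX : ∀ ω ω', ω i = ω' i → X ω = X ω')
    (hY : ∀ ω a, Y (Function.update ω i a) = Y ω) :
    entropy (fun ω => (X ω, Y ω)) = entropy X + entropy Y := by
  refine entropy_pair_of_indep X Y fun ω => ?_
  simp only [fiberCard]
  rw [← Finset.card_univ, ← Finset.card_product, ← Finset.card_product]
  -- Exchanging the `i`-th coordinates of two sample points is an involution; it separates the
  -- condition on `X` from the condition on `Y`.
  refine Finset.card_nbij'
    (fun p => (Function.update p.2 i (p.1 i), Function.update p.1 i (p.2 i)))
    (fun p => (Function.update p.2 i (p.1 i), Function.update p.1 i (p.2 i))) ?_ ?_ ?_ ?_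
  · rintro ⟨a, b⟩ h
    simp only [Finset.coe_product, Finset.coe_filter, Set.mem_prod, Set.mem_ofPred_eq,
      Finset.mem_univ, true_and, Prod.mk.injEq] at h ⊢
    exact ⟨(hX _ a (by simp)).trans h.1.1, (hY _ _).trans h.1.2⟩
  · rintro ⟨a, b⟩ h
    simp only [Finset.coe_product, Finset.coe_filter, Set.mem_prod, Set.mem_ofPred_eq,
      Finset.mem_univ, true_and, Prod.mk.injEq, Finset.coe_univ, Set.mem_univ, and_true] at h ⊢
    exact ⟨(hX _ a (by simp)).trans h.1, (hY _ _).trans h.2⟩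
  · rintro ⟨a, b⟩ -
    simp
  · rintro ⟨a, b⟩ -
    simp

theorem fiberCard_coordinate (i : ι) (f : Ω i → α) (a : α) :
    fiberCard (fun ω : ∀ i, Ω i => f (ω i)) a * Fintype.card (Ω i) =
      fiberCard f a * Fintype.card (∀ i, Ω i) := by
  have h : (Finset.univ.filter fun ω : ∀ i, Ω i => f (ω i) = a) =
      Fintype.piFinset (Function.update (fun j => (Finset.univ : Finset (Ω j))) i
        (Finset.univ.filter fun x => f x = a)) := by
    ext ω
    simp only [Finset.mem_filter, Finset.mem_univ, true_and, Fintype.mem_piFinset]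
    constructor
    · intro h j
      by_cases e : j = i
      · subst e
        simpa using h
      · simp [e]
    · intro h
      simpa using h i
  rw [fiberCard, h, Fintype.card_piFinset, Fintype.card_pi,
    ← Finset.mul_prod_erase Finset.univ _ (Finset.mem_univ i),
    ← Finset.mul_prod_erase Finset.univ (fun j => Fintype.card (Ω j)) (Finset.mem_univ i)]
  have : ∏ j ∈ Finset.univ.erase i, (Function.update (fun j => (Finset.univ : Finset (Ω j))) i
        (Finset.univ.filter fun x => f x = a) j).card =
      ∏ j ∈ Finset.univ.erase i, Fintype.card (Ω j) :=
    Finset.prod_congr rfl fun j hj => by simp [Finset.ne_of_mem_erase hj]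
  rw [this]
  simp only [Function.update_self, fiberCard]
  ring

theorem logb_card_le_entropy_coordinate [∀ i, Nonempty (Ω i)] [∀ i, DecidableEq (Ω i)] (i : ι) :
    Real.logb 2 (Fintype.card (Ω i)) ≤ entropy (fun ω : ∀ i, Ω i => ω i) := by
  refine logb_le_entropy _ (by exact_mod_cast Fintype.card_pos) fun ω => ?_
  have h := fiberCard_coordinate i (fun x : Ω i => x) (ω i)
  have h1 : fiberCard (fun x : Ω i => x) (ω i) = 1 := by simp [fiberCard, Finset.filter_eq']
  rw [h1, one_mul] at h
  exact_mod_cast h.le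

end Product

/-! ### Potentials from the cycle bounds -/

section Potential

variable {K : ℕ} (n : Fin K → Fin K → ℕ)

/-- The total weight of the edges of a path. -/
def trailWeight : List (Fin K) → ℕ
  | [] => 0
  | [_] => 0
  | i :: j :: l => edgeWeight n i j + trailWeight (j :: l)

theorem trailWeight_append (A : List (Fin K)) (i : Fin K) (B : List (Fin K)) :
    trailWeight n (A ++ i :: B) = trailWeight n (A ++ [i]) + trailWeight n (i :: B) := by
  induction A with
  | nil => simp [trailWeight]
  | cons a A ih =>
    cases A with
    | nil => simp [trailWeight]
    | cons b A =>
      simp only [List.cons_append, trailWeight] at ih ⊢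
      rw [ih, add_assoc]

theorem trailWeight_le_append (A B : List (Fin K)) :
    trailWeight n A ≤ trailWeight n (A ++ B) := by
  induction A with
  | nil => simp [trailWeight]
  | cons a A ih =>
    cases A with
    | nil => simp [trailWeight]
    | cons b A =>
      simp only [List.cons_append, trailWeight] at ih ⊢
      omega

theorem sum_edgeWeight_get (v : Fin K) (l : List (Fin K)) (z : Fin K) :
    ∑ i : Fin l.length, edgeWeight n ((v :: l).get i.castSucc) ((v :: l).get i.succ) +
      edgeWeight n ((v :: l).get (Fin.last l.length)) z = trailWeight n (v :: l ++ [z]) := by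
  induction l generalizing v with
  | nil => simp [trailWeight]
  | cons w l ih =>
    have h := ih w
    simp only [List.length_cons] at h ⊢
    rw [Fin.sum_univ_succ, add_assoc]
    simp only [List.cons_append, trailWeight] at h ⊢
    rw [← h]
    rfl

variable {n}

/-- The cycle bound in list form: no closed simple path has negative length. -/
theorem trailWeight_le_of_mem_cycleRegion {R : Fin K → ℝ} (hR : R ∈ cycleRegion n)
    (v : Fin K) (l : List (Fin K)) (hl : (v :: l).Nodup) :
    (trailWeight n (v :: l ++ [v]) : ℝ) ≤ ((v :: l).map fun k => (n k k : ℝ) - R k).sum := by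
  have h := hR.2 ⟨l.length, (v :: l).get, List.nodup_iff_injective_get.mp hl⟩
  have hw : UserCycle.weight n ⟨l.length, (v :: l).get, List.nodup_iff_injective_get.mp hl⟩ =
      trailWeight n (v :: l ++ [v]) := by
    rw [← sum_edgeWeight_get, UserCycle.weight, Fin.sum_univ_castSucc]
    simp only [Fin.coeSucc_eq_succ, Fin.last_add_one]
    rfl
  rw [hw] at h
  have hs : ((v :: l).map fun k => (n k k : ℝ) - R k).sum =
      ∑ i : Fin (l.length + 1), ((n ((v :: l).get i) ((v :: l).get i) : ℝ) - R ((v :: l).get i)) := by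
    rw [← List.sum_ofFn]
    congr 1
    refine List.ext_getElem (by simp) fun i _ _ => ?_
    rw [List.getElem_map, List.getElem_ofFn]
    rfl
  rw [hs, Finset.sum_sub_distrib]
  linarith

/-- The potential theorem: the cycle bounds yield real power back-offs `r`. -/
theorem exists_potential {R : Fin K → ℝ} (hR : R ∈ cycleRegion n) :
    ∃ r : Fin K → ℝ, (∀ k, 0 ≤ r k) ∧ (∀ k, r k + R k ≤ n k k) ∧
      ∀ k j, j ≠ k → r k + R k + n k j ≤ n k k + r j := by
  -- The potential at `k` is the least cost `c` of a simple path starting at `k`. The cost counts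
  -- `d` at every vertex, the last one included.
  let d : Fin K → ℝ := fun k => (n k k : ℝ) - R k
  let c : List (Fin K) → ℝ := fun l => (l.map d).sum - trailWeight n l
  have hfin : ∀ k : Fin K, {l : List (Fin K) | (k :: l).Nodup}.Finite := fun k => by
    refine (Set.toFinite (Set.range fun l : {l : List (Fin K) // l.Nodup} => l.1)).subset ?_
    intro l hl
    exact ⟨⟨l, (List.nodup_cons.mp hl).2⟩, rfl⟩
  have hmin : ∀ k : Fin K, ∃ l, (k :: l).Nodup ∧
      ∀ l', (k :: l').Nodup → c (k :: l) ≤ c (k :: l') := fun k => by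
    obtain ⟨l, hl, hm⟩ := Set.exists_min_image _ (fun l => c (k :: l)) (hfin k)
      ⟨[], List.nodup_singleton k⟩
    exact ⟨l, hl, hm⟩
  choose p hp hpmin using hmin
  refine ⟨fun k => c (k :: p k), fun k => ?_, fun k => ?_, fun k j hjk => ?_⟩
  -- Closing the path into a cycle can only increase its weight, so the cycle bound makes the cost
  -- nonnegative.
  · have h1 := trailWeight_le_of_mem_cycleRegion hR k (p k) (hp k)
    have h2 : (trailWeight n (k :: p k) : ℝ) ≤ trailWeight n (k :: p k ++ [k]) := by
      exact_mod_cast trailWeight_le_append n _ _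
    simp only [c, d]
    linarith
  · have := hpmin k [] (List.nodup_singleton k)
    simp only [c, d, trailWeight, List.map_cons, List.map_nil, List.sum_cons, List.sum_nil] at this ⊢
    push_cast at this
    linarith
  · have he : edgeWeight n k j = n k j := if_neg hjk.symm
    -- Putting `k` in front of the optimal path from `j` gives a candidate path from `k`. If `k` is
    -- already on that path, the cycle through `k` and `j` is cut off; its length is nonnegative.
    by_cases hk : k ∈ j :: p j
    · obtain ⟨A, B, hAB⟩ := List.append_of_mem ((List.mem_cons.mp hk).resolve_left hjk.symm)
      have hnd := hp j
      rw [hAB] at hnd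
      have hB : (k :: B).Nodup :=
        hnd.sublist ((List.sublist_append_right A (k :: B)).trans (List.sublist_cons_self _ _))
      have hC : (k :: j :: A).Nodup := by
        rw [List.nodup_cons]
        have h' : ((j :: A) ++ k :: B).Nodup := hnd
        rw [List.nodup_append] at h'
        exact ⟨fun hm => h'.2.2 k hm k (by simp) rfl, h'.1⟩
      have h1 := hpmin k B hB
      have h2 := trailWeight_le_of_mem_cycleRegion hR k (j :: A) hC
      have h3 : trailWeight n (k :: (j :: A) ++ [k]) =
          n k j + trailWeight n (j :: A ++ [k]) := by rw [← he]; rfl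
      have h4 : trailWeight n (j :: p j) =
          trailWeight n (j :: A ++ [k]) + trailWeight n (k :: B) := by
        rw [hAB]
        exact trailWeight_append n (j :: A) k B
      have h5 : ((j :: p j).map d).sum = ((j :: A).map d).sum + ((k :: B).map d).sum := by
        rw [hAB]
        simp [add_assoc]
      have h6 : ((k :: j :: A).map fun k => (n k k : ℝ) - R k).sum =
          d k + ((j :: A).map d).sum := by simp [d]
      rw [h3, h6] at h2
      push_cast at h2
      simp only [c] at h1 ⊢
      rw [h4, h5]
      push_cast
      simp only [d] at *
      linarith
    · have := hpmin k (j :: p j) (List.nodup_cons.mpr ⟨hk, hp j⟩)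
      have h3 : trailWeight n (k :: j :: p j) = n k j + trailWeight n (j :: p j) := by
        rw [← he]; rfl
      have h6 : ((k :: j :: p j).map d).sum = d k + ((j :: p j).map d).sum := by simp
      simp only [c] at this ⊢
      rw [h3, h6] at this
      push_cast at this
      simp only [d] at *
      linarith

/-! ### Rounding real back-offs over time slots -/

theorem sum_add_div (T : ℕ) (hT : 0 < T) (m : ℕ) : ∑ t : Fin T, (m + t) / T = m := by
  rw [Fin.sum_univ_eq_sum_range (fun t => (m + t) / T)]
  induction m with
  | zero =>
    exact Finset.sum_eq_zero fun t ht => by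
      simpa using Nat.div_eq_of_lt (Finset.mem_range.mp ht)
  | succ m ih =>
    -- Passing from `m` to `m + 1` shifts the window of summation: `m / T` leaves and `(m + T) / T =
    -- m / T + 1` enters.
    have h1 := Finset.sum_range_succ (fun t => (m + t) / T) T
    have h2 := Finset.sum_range_succ' (fun t => (m + t) / T) T
    rw [ih, Nat.add_div_right _ hT] at h1
    simp only [add_zero] at h2
    have h3 : ∑ t ∈ Finset.range T, (m + 1 + t) / T = ∑ t ∈ Finset.range T, (m + (t + 1)) / T :=
      Finset.sum_congr rfl fun t _ => by congr 1; omega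
    omega

/-- Hermite's identity. -/
theorem sum_floor_add_div (T : ℕ) (hT : 0 < T) {x : ℝ} (hx : 0 ≤ x) :
    ∑ t : Fin T, ⌊x + (t : ℕ) / (T : ℝ)⌋₊ = ⌊T * x⌋₊ := by
  rw [← sum_add_div T hT ⌊T * x⌋₊]
  refine Finset.sum_congr rfl fun t _ => ?_
  have hT' : (0 : ℝ) < T := by exact_mod_cast hT
  rw [← Nat.floor_add_natCast (by positivity), ← Nat.floor_div_natCast]
  congr 1
  field_simp

/-- Integer back-offs `r` and rates `m` for `T` slots, whose average rates approximate a given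
point of the cycle region. -/
theorem exists_slots {R : Fin K → ℝ} (hR : R ∈ cycleRegion n) (T : ℕ) :
    ∃ r m : Fin T → Fin K → ℕ, (∀ t k, m t k + r t k ≤ n k k) ∧
      (∀ t k j, j ≠ k → m t k + r t k + n k j ≤ n k k + r t j) ∧
      ∀ k, T * R k - 1 ≤ ∑ t, (m t k : ℝ) := by
  obtain ⟨r, hr0, hr1, hr2⟩ := exists_potential hR
  let f : Fin T → ℝ → ℕ := fun t x => ⌊x + (t : ℕ) / (T : ℝ)⌋₊
  have hlt : ∀ t : Fin T, ((t : ℕ) / (T : ℝ) : ℝ) < 1 := fun t => by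
    rw [div_lt_one (by exact_mod_cast t.pos)]
    exact_mod_cast t.isLt
  have hge : ∀ t : Fin T, (0 : ℝ) ≤ (t : ℕ) / (T : ℝ) := fun t => by positivity
  have hmono : ∀ t k, f t (r k) ≤ f t (r k + R k) := fun t k =>
    Nat.floor_mono (by linarith [hR.1 k])
  -- Both ends of the occupied interval are rounded with the same offset. Since `n` is integral, the
  -- monotone rounding preserves every inequality between them.
  refine ⟨fun t k => f t (r k), fun t k => f t (r k + R k) - f t (r k), fun t k => ?_,
    fun t k j hjk => ?_, fun k => ?_⟩
  · rw [Nat.sub_add_cancel (hmono t k)]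
    refine Nat.lt_succ_iff.mp ((Nat.floor_lt' (by omega)).mpr ?_)
    push_cast
    linarith [hr1 k, hlt t]
  · rw [Nat.sub_add_cancel (hmono t k)]
    simp only [f]
    have := hge t
    rw [← Nat.floor_add_natCast (by linarith [hr0 k, hR.1 k]), add_comm (n k k),
      ← Nat.floor_add_natCast (by linarith [hr0 j])]
    exact Nat.floor_mono (by linarith [hr2 k j hjk])
  · rcases Nat.eq_zero_or_pos T with rfl | hT
    · simp
    have h1 : ∑ t, ((f t (r k + R k) - f t (r k) : ℕ) : ℝ) =
        (⌊T * (r k + R k)⌋₊ : ℝ) - ⌊T * r k⌋₊ := by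
      rw [← sum_floor_add_div T hT (by linarith [hr0 k, hR.1 k]),
        ← sum_floor_add_div T hT (hr0 k)]
      push_cast
      rw [← Finset.sum_sub_distrib]
      exact Finset.sum_congr rfl fun t _ => Nat.cast_sub (hmono t k)
    rw [h1]
    have h2 := Nat.lt_floor_add_one (T * (r k + R k))
    have h3 := Nat.floor_le (mul_nonneg (Nat.cast_nonneg T) (hr0 k))
    linarith

end Potential

/-! ### Achievability -/

section Achievability

variable {K : ℕ} {n : Fin K → Fin K → ℕ}

theorem fold_xor_lt (s : ℕ) (a : Fin K → ℕ) (S : Finset (Fin K)) (h : ∀ i ∈ S, a i < 2 ^ s) :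
    S.fold (fun a b : ℕ => a ^^^ b) 0 a < 2 ^ s := by
  induction S using Finset.induction_on with
  | empty => simp
  | insert i S hi ih =>
    rw [Finset.fold_insert hi]
    exact Nat.xor_lt_two_pow (h i (Finset.mem_insert_self i S))
      (ih fun j hj => h j (Finset.mem_insert_of_mem hj))

theorem xor_div_two_pow (a b s : ℕ) : (a ^^^ b) / 2 ^ s = (a / 2 ^ s) ^^^ (b / 2 ^ s) := by
  simp only [← Nat.shiftRight_eq_div_pow, Nat.shiftRight_xor_distrib]

theorem output_eq_xor_erase (n : Fin K → Fin K → ℕ) (k : Fin K) (x : Fin K → ℝ) :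
    output n k x = ⌊(2 : ℝ) ^ n k k * x k⌋₊ ^^^
      (Finset.univ.erase k).fold (fun a b : ℕ => a ^^^ b) 0
        (fun i => ⌊(2 : ℝ) ^ n k i * x i⌋₊) := by
  rw [output, ← Finset.insert_erase (Finset.mem_univ k), Finset.fold_insert (by simp)]
  simp

theorem output_div_two_pow (k : Fin K) (x : Fin K → ℝ) (s : ℕ)
    (h : ∀ i, i ≠ k → ⌊(2 : ℝ) ^ n k i * x i⌋₊ < 2 ^ s) :
    output n k x / 2 ^ s = ⌊(2 : ℝ) ^ n k k * x k⌋₊ / 2 ^ s := by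
  rw [output_eq_xor_erase, xor_div_two_pow,
    Nat.div_eq_of_lt (fold_xor_lt s _ _ fun i hi => h i (Finset.ne_of_mem_erase hi)),
    Nat.xor_zero]

/-- By `h2` all interference lies in the lowest `n k k - (m + r k)` levels, so discarding these
leaves the top `m` bits of user `k`. The bit counts `l` are free: `maxLevel n` for TIN inputs, the
slot's level counts for codes. -/
theorem output_backoff (k : Fin K) (r l : Fin K → ℕ) (m : ℕ) (hm : m ≤ l k) (a : Fin K → ℕ)
    (ha : ∀ i, a i < 2 ^ l i) (h1 : m + r k ≤ n k k)
    (h2 : ∀ j, j ≠ k → m + r k + n k j ≤ n k k + r j) :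
    output n k (fun i => (a i : ℝ) / 2 ^ (l i + r i)) / 2 ^ (n k k - (m + r k)) =
      a k / 2 ^ (l k - m) := by
  rw [output_div_two_pow]
  · obtain ⟨s, hs⟩ := Nat.exists_eq_add_of_le h1
    obtain ⟨u, hu⟩ := Nat.exists_eq_add_of_le hm
    have e : (2 : ℝ) ^ n k k * ((a k : ℝ) / 2 ^ (l k + r k)) =
        (a k : ℝ) / (2 ^ u : ℕ) * (2 ^ s : ℕ) := by
      rw [hs, hu]
      push_cast
      field_simp
      ring
    rw [show n k k - (m + r k) = s by omega, show l k - m = u by omega, e,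
      ← Nat.floor_div_natCast, mul_div_cancel_right₀ _ (by positivity), Nat.floor_div_eq_div]
  · intro i hi
    rw [Nat.floor_lt (by positivity)]
    have h3 : n k i ≤ (n k k - (m + r k)) + r i := by have := h2 i hi; omega
    have h4 : (a i : ℝ) < 2 ^ l i := by exact_mod_cast ha i
    calc (2 : ℝ) ^ n k i * ((a i : ℝ) / 2 ^ (l i + r i))
        < (2 : ℝ) ^ n k i * ((2 : ℝ) ^ l i / 2 ^ (l i + r i)) := by gcongr
      _ ≤ (2 : ℝ) ^ ((n k k - (m + r k)) + r i) * ((2 : ℝ) ^ l i / 2 ^ (l i + r i)) := by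
        gcongr
        norm_num
      _ = ((2 ^ (n k k - (m + r k)) : ℕ) : ℝ) := by
        push_cast
        field_simp
        ring

theorem le_maxLevel (n : Fin K → Fin K → ℕ) (k i : Fin K) : n k i ≤ maxLevel n :=
  (Finset.le_sup (f := fun i => n k i) (Finset.mem_univ i)).trans
    (Finset.le_sup (f := fun k => Finset.univ.sup fun i => n k i) (Finset.mem_univ k))

theorem tinInput_eq_iff (L : ℕ) (r : Fin K → ℕ) (k : Fin K) (ω ω' : Bits K L) :
    tinInput L r k ω = tinInput L r k ω' ↔ ω k = ω' k := by
  rw [tinInput, tinInput, div_left_inj' (by positivity), Nat.cast_inj, Fin.ext_iff]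

theorem le_tinRate (k : Fin K) (r : Fin K → ℕ) (m : ℕ) (h1 : m + r k ≤ n k k)
    (h2 : ∀ j, j ≠ k → m + r k + n k j ≤ n k k + r j) : (m : ℝ) ≤ tinRate n r k := by
  set L := maxLevel n with hL
  have hm : m ≤ L := by have := le_maxLevel n k k; omega
  have hZ : ∀ ω : Bits K L, output n k (fun i => tinInput L r i ω) / 2 ^ (n k k - (m + r k)) =
      (ω k : ℕ) / 2 ^ (L - m) := fun ω =>
    output_backoff k r (fun _ => L) m hm (fun i => (ω i : ℕ)) (fun i => (ω i).isLt) h1 h2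
  have hI : entropy (fun ω : Bits K L => (ω k : ℕ) / 2 ^ (L - m)) ≤ tinRate n r k := by
    refine entropy_le_mutualInfo (fun ω ω' e => ?_) (fun ω ω' e => ?_)
    · rw [(tinInput_eq_iff L r k ω ω').mp e]
    · rw [← hZ, ← hZ, e]
  refine le_trans ?_ hI
  have := logb_le_entropy (fun ω : Bits K L => (ω k : ℕ) / 2 ^ (L - m)) (M := 2 ^ m)
    (by positivity) fun ω => ?_
  · rwa [Real.logb_pow, Real.logb_self_eq_one (by norm_num), mul_one] at this
  -- The top `m` of `L` fair bits take each value with probability at most `2 ^ (-m)`.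
  · have hc := fiberCard_coordinate (Ω := fun _ : Fin K => Fin (2 ^ L)) k
      (fun x => (x : ℕ) / 2 ^ (L - m)) ((ω k : ℕ) / 2 ^ (L - m))
    have hf : fiberCard (fun x : Fin (2 ^ L) => (x : ℕ) / 2 ^ (L - m)) ((ω k : ℕ) / 2 ^ (L - m)) ≤
        2 ^ (L - m) := by
      set b := (ω k : ℕ) / 2 ^ (L - m)
      rw [fiberCard, ← Finset.card_map Fin.valEmbedding]
      have hsub : (Finset.univ.filter fun x : Fin (2 ^ L) => (x : ℕ) / 2 ^ (L - m) = b).map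
          Fin.valEmbedding ⊆ Finset.Ico (b * 2 ^ (L - m)) (b * 2 ^ (L - m) + 2 ^ (L - m)) := by
        intro y hy
        obtain ⟨x, hx, rfl⟩ := Finset.mem_map.mp hy
        have hx' := (Finset.mem_filter.mp hx).2
        rw [Nat.div_eq_iff (by positivity)] at hx'
        have : 0 < 2 ^ (L - m) := by positivity
        simp only [Fin.valEmbedding_apply, Finset.mem_Ico]
        omega
      simpa using Finset.card_le_card hsub
    rw [Fintype.card_fin] at hc
    have h2L : 2 ^ L = 2 ^ (L - m) * 2 ^ m := by rw [← pow_add]; congr 1; omega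
    have hle : fiberCard (fun ω : Bits K L => (ω k : ℕ) / 2 ^ (L - m))
        ((ω k : ℕ) / 2 ^ (L - m)) * 2 ^ m ≤ Fintype.card (Bits K L) := by
      have hpos : 0 < 2 ^ (L - m) := by positivity
      refine Nat.le_of_mul_le_mul_left ?_ hpos
      calc 2 ^ (L - m) * (fiberCard (fun ω : Bits K L => (ω k : ℕ) / 2 ^ (L - m))
            ((ω k : ℕ) / 2 ^ (L - m)) * 2 ^ m)
          = fiberCard (fun ω : Bits K L => (ω k : ℕ) / 2 ^ (L - m))
            ((ω k : ℕ) / 2 ^ (L - m)) * 2 ^ L := by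
            rw [mul_left_comm, ← h2L]
        _ = _ := hc
        _ ≤ _ := Nat.mul_le_mul_right _ hf
    exact_mod_cast hle

/-- Room for the rounding loss; the truncation at `0` keeps the smaller rates nonnegative. -/
theorem mem_closure_of_forall_max_sub {S : Set (Fin K → ℝ)} {R : Fin K → ℝ} (hR : ∀ k, 0 ≤ R k)
    (h : ∀ ε > 0, (fun k => max (R k - ε) 0) ∈ S) : R ∈ closure S := by
  refine Metric.mem_closure_iff.mpr fun ε hε => ⟨_, h (ε / 2) (by positivity), ?_⟩
  refine lt_of_le_of_lt ((dist_pi_le_iff (by positivity : 0 ≤ ε / 2)).mpr fun k => ?_)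
    (half_lt_self hε)
  rw [Real.dist_eq, abs_le]
  rcases max_cases (R k - ε / 2) 0 with h | h <;> constructor <;> linarith [hR k, h.1, h.2]

theorem cycleRegion_subset_tinRegion : cycleRegion n ⊆ tinRegion n := by
  intro R hR
  refine mem_closure_of_forall_max_sub hR.1 fun ε hε => ⟨fun k => le_max_right _ _, ?_⟩
  obtain ⟨T, hT⟩ := exists_nat_gt (1 / ε)
  have hT0 : (0 : ℝ) < T := lt_trans (by positivity) hT
  rw [div_lt_iff₀ hε] at hT
  obtain ⟨r, m, h1, h2, h3⟩ := exists_slots hR T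
  refine ⟨T, by exact_mod_cast hT0, r, fun k => ?_⟩
  have hsum : ∑ t, (m t k : ℝ) ≤ ∑ t, tinRate n (r t) k :=
    Finset.sum_le_sum fun t _ => le_tinRate k (r t) (m t k) (h1 t k) (h2 t k)
  rw [le_div_iff₀ hT0, max_mul_of_nonneg _ _ hT0.le]
  refine (max_le ?_ ?_).trans hsum
  · refine le_trans ?_ (h3 k)
    linarith
  · rw [zero_mul]
    positivity

/-! ### Zero-error codes -/

theorem numMessages_pos (N : ℕ) (R : ℝ) : 0 < numMessages N R :=
  Nat.ceil_pos.mpr (by positivity)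

/-- Uncoded transmission over the levels left free by the power back-offs has no errors. -/
theorem exists_code_errorProb_eq_zero {N : ℕ} {M : Fin K → ℕ} (hM : ∀ k, 0 < M k)
    (r m : Fin N → Fin K → ℕ) (h1 : ∀ t k, m t k + r t k ≤ n k k)
    (h2 : ∀ t k j, j ≠ k → m t k + r t k + n k j ≤ n k k + r t j)
    (h3 : ∀ k, M k ≤ 2 ^ ∑ t, m t k) : ∃ c : Code K N M, ∀ k, c.errorProb n k = 0 := by
  have hemb : ∀ k, Nonempty (Fin (M k) ↪ ((t : Fin N) → Fin (2 ^ m t k))) := fun k =>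
    Function.Embedding.nonempty_of_card_le (by simpa [Finset.prod_pow_eq_pow_sum] using h3 k)
  let φ := fun k => (hemb k).some
  have : ∀ k, Nonempty (Fin (M k)) := fun k => ⟨⟨0, hM k⟩⟩
  let c : Code K N M :=
    { enc := fun i w t => ((φ i w t : ℕ) : ℝ) / 2 ^ (m t i + r t i)
      enc_mem := fun i w t => by
        refine ⟨by positivity, (div_lt_one (by positivity)).mpr ?_⟩
        exact_mod_cast (φ i w t).isLt.trans_le (Nat.pow_le_pow_right two_pos (by omega))
      dec := fun k y => Function.invFun (fun w t => ((φ k w t : ℕ)))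
        (fun t => y t / 2 ^ (n k k - (m t k + r t k))) }
  refine ⟨c, fun k => ?_⟩
  have hinj : Function.Injective fun (w : Fin (M k)) (t : Fin N) => ((φ k w t : ℕ)) := by
    intro w w' e
    exact (φ k).injective (funext fun t => Fin.ext (congrFun e t))
  have hdec : ∀ w : (i : Fin K) → Fin (M i), c.dec k (c.received n w k) = w k := by
    intro w
    have : (fun t => c.received n w k t / 2 ^ (n k k - (m t k + r t k))) =
        fun t => ((φ k (w k) t : ℕ)) := by
      funext t
      have := output_backoff k (r t) (m t) (m t k) le_rfl (fun i => (φ i (w i) t : ℕ))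
        (fun i => (φ i (w i) t).isLt) (h1 t k) (h2 t k)
      rw [Nat.sub_self, pow_zero, Nat.div_one] at this
      exact this
    change Function.invFun _ (fun t => c.received n w k t / 2 ^ (n k k - (m t k + r t k))) = _
    rw [this]
    exact Function.leftInverse_invFun hinj (w k)
  simp [Code.errorProb, hdec]

theorem cycleRegion_subset_capacityRegion : cycleRegion n ⊆ capacityRegion n := by
  intro R hR
  refine mem_closure_of_forall_max_sub hR.1 fun ε hε => ⟨fun k => le_max_right _ _, ?_⟩
  have hcode : ∀ N : ℕ, ∃ c : Code K N (fun i => numMessages N (max (R i - ε) 0)),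
      -- From `1 / ε ≤ N` on, the reduction `N * ε` of the payload covers the rounding loss of one
      -- bit; shorter blocks may use any code.
      1 / ε ≤ N → ∀ k, c.errorProb n k = 0 := by
    intro N
    by_cases hN : 1 / ε ≤ N
    · obtain ⟨r, m, h1, h2, h3⟩ := exists_slots hR N
      have hM : ∀ k, numMessages N (max (R k - ε) 0) ≤ 2 ^ ∑ t, m t k := by
        intro k
        rw [div_le_iff₀ hε] at hN
        refine Nat.ceil_le.mpr ?_
        push_cast
        rw [← Real.rpow_natCast]
        refine Real.rpow_le_rpow_of_exponent_le (by norm_num) ?_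
        push_cast
        rw [mul_max_of_nonneg _ _ (Nat.cast_nonneg N)]
        refine max_le ?_ ?_
        · refine le_trans ?_ (h3 k)
          linarith
        · rw [mul_zero]
          positivity
      obtain ⟨c, hc⟩ := exists_code_errorProb_eq_zero (fun k => numMessages_pos N _) r m h1 h2 hM
      exact ⟨c, fun _ => hc⟩
    · exact ⟨⟨fun _ _ _ => 0, fun _ _ _ => by simp, fun k _ => ⟨0, numMessages_pos _ _⟩⟩,
        fun h => absurd h hN⟩
  choose c hc using hcode
  refine ⟨c, fun k => ?_⟩
  refine tendsto_const_nhds.congr' ?_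
  filter_upwards [Filter.eventually_ge_atTop ⌈1 / ε⌉₊] with N hN
  exact (hc N (Nat.ceil_le.mp hN) k).symm

end Achievability


/-! ### The converse -/

section Converse

variable {K N : ℕ} {n : Fin K → Fin K → ℕ}

/-- The form in which the TIN condition enters the converse. Edges from a user to itself weigh `0`,
so coincident users, and with them trivial cycles, are covered. -/
theorem edgeWeight_add_le (h : TINCondition n) (i k j : Fin K) :
    edgeWeight n i k + edgeWeight n k j ≤ n k k := by
  have h1 : edgeWeight n i k ≤ (Finset.univ.erase k).sup (fun j => n j k) := by
    unfold edgeWeight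
    split_ifs with e
    · exact Nat.zero_le _
    · exact Finset.le_sup (f := fun j => n j k) (by simp [e])
  have h2 : edgeWeight n k j ≤ (Finset.univ.erase k).sup (fun j => n k j) := by
    unfold edgeWeight
    split_ifs with e
    · exact Nat.zero_le _
    · exact Finset.le_sup (f := fun j => n k j) (by simp [Ne.symm e])
  exact (add_le_add h1 h2).trans (h k)

/-- The signal that user `k` causes at receiver `i` over the link of weight `edgeWeight n i k`. -/
noncomputable def crossSignal (n : Fin K → Fin K → ℕ) (i k : Fin K) (x : Fin N → ℝ) (t : Fin N) :
    ℕ :=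
  ⌊(2 : ℝ) ^ edgeWeight n i k * x t⌋₊

theorem floor_two_pow_mul_lt {m : ℕ} {y : ℝ} (hy : y ∈ Set.Ico (0 : ℝ) 1) :
    ⌊(2 : ℝ) ^ m * y⌋₊ < 2 ^ m := by
  rw [Nat.floor_lt (mul_nonneg (by positivity) hy.1)]
  push_cast
  exact mul_lt_of_lt_one_right (by positivity) hy.2

theorem floor_two_pow_mul_div {m e : ℕ} (h : e ≤ m) (y : ℝ) :
    ⌊(2 : ℝ) ^ m * y⌋₊ / 2 ^ (m - e) = ⌊(2 : ℝ) ^ e * y⌋₊ := by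
  obtain ⟨u, rfl⟩ := Nat.exists_eq_add_of_le h
  rw [Nat.add_sub_cancel_left, ← Nat.floor_div_natCast]
  congr 1
  push_cast
  field_simp
  ring

theorem output_eq_xor_cross (n : Fin K → Fin K → ℕ) (k j : Fin K) {x : Fin K → ℝ}
    (hx : ∀ i, x i ∈ Set.Ico (0 : ℝ) 1) :
    output n k x = ⌊(2 : ℝ) ^ n k k * x k⌋₊ ^^^ ⌊(2 : ℝ) ^ edgeWeight n k j * x j⌋₊ ^^^
      ((Finset.univ.erase k).erase j).fold (fun a b : ℕ => a ^^^ b) 0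
        (fun i => ⌊(2 : ℝ) ^ n k i * x i⌋₊) := by
  rw [output_eq_xor_erase, Nat.xor_assoc]
  congr 1
  by_cases e : k = j
  · subst e
    have : ⌊(2 : ℝ) ^ edgeWeight n k k * x k⌋₊ = 0 := by
      simp [edgeWeight, Nat.floor_eq_zero, (hx k).2]
    rw [this, Nat.zero_xor, Finset.erase_eq_of_notMem (s := Finset.univ.erase k) (by simp)]
  · rw [edgeWeight, if_neg e]
    conv_lhs => rw [← Finset.insert_erase (s := Finset.univ.erase k) (a := j)
      (by simp [Ne.symm e]), Finset.fold_insert (by simp)]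

theorem fold_xor_congr (k j : Fin K) {x x' : Fin K → ℝ}
    (h : ∀ i, i ≠ k → i ≠ j → x i = x' i) :
    ((Finset.univ.erase k).erase j).fold (fun a b : ℕ => a ^^^ b) 0
        (fun i => ⌊(2 : ℝ) ^ n k i * x i⌋₊) =
      ((Finset.univ.erase k).erase j).fold (fun a b : ℕ => a ^^^ b) 0
        (fun i => ⌊(2 : ℝ) ^ n k i * x' i⌋₊) := by
  refine Finset.fold_congr fun i hi => ?_
  simp only [Finset.mem_erase] at hi
  rw [h i hi.2.1 hi.1]

variable {Ω : Fin K → Type} [∀ i, Fintype (Ω i)] [∀ i, Nonempty (Ω i)] [∀ i, DecidableEq (Ω i)]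

/-- The sequence received by receiver `k` when user `i` sends `x i` of its own randomness. -/
noncomputable def receivedSeq (n : Fin K → Fin K → ℕ) (x : ∀ i, Ω i → Fin N → ℝ) (k : Fin K)
    (ω : ∀ i, Ω i) (t : Fin N) : ℕ :=
  output n k fun i => x i (ω i) t

/-- A genie gives receiver `k` the signal `S` that its own user causes at `i`, and the inputs'
randomness `O` of all users but `k` and `j`. What remains unknown of the output is `Q`, at most `n k
k - edgeWeight n i k` bits per use. Knowing also `W`, the receiver still sees the interference `A`,
independent of `W` and `O`. -/
theorem mutualInfo_receivedSeq_le (h : TINCondition n) (x : ∀ i, Ω i → Fin N → ℝ)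
    (hx : ∀ i w t, x i w t ∈ Set.Ico (0 : ℝ) 1) (i k j : Fin K) :
    mutualInfo (fun ω : ∀ i, Ω i => ω k) (receivedSeq n x k) ≤
      entropy (fun ω : ∀ i, Ω i => crossSignal n i k (x k (ω k))) +
        N * ((n k k : ℝ) - edgeWeight n i k) -
        entropy (fun ω : ∀ i, Ω i => crossSignal n k j (x j (ω j))) := by
  have hc := edgeWeight_add_le h i k j
  let W := fun ω : ∀ i, Ω i => ω k
  let Y := receivedSeq n x k
  let S := fun ω : ∀ i, Ω i => crossSignal n i k (x k (ω k))
  let A := fun ω : ∀ i, Ω i => crossSignal n k j (x j (ω j))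
  let O := fun (ω : ∀ i, Ω i) (l : {l : Fin K // l ≠ k ∧ l ≠ j}) => ω l
  let D := fun (ω : ∀ i, Ω i) (t : Fin N) =>
    (⌊(2 : ℝ) ^ n k k * x k (ω k) t⌋₊ ^^^ crossSignal n k j (x j (ω j)) t)
  let Q := fun (ω : ∀ i, Ω i) (t : Fin N) => D ω t % 2 ^ (n k k - edgeWeight n i k)
  have hO : ∀ ω ω', O ω = O ω' → ∀ l, l ≠ k → l ≠ j → ω l = ω' l := fun ω ω' e l h1 h2 =>
    congrFun e ⟨l, h1, h2⟩
  let ρ := fun (ω : ∀ i, Ω i) (t : Fin N) =>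
    ((Finset.univ.erase k).erase j).fold (fun a b : ℕ => a ^^^ b) 0
      (fun i => ⌊(2 : ℝ) ^ n k i * x i (ω i) t⌋₊)
  have hY : ∀ ω t, Y ω t = D ω t ^^^ ρ ω t := fun ω t =>
    output_eq_xor_cross n k j fun i => hx i (ω i) t
  have hρ : ∀ ω ω', O ω = O ω' → ρ ω = ρ ω' := fun ω ω' e => funext fun t =>
    fold_xor_congr k j fun l h1 h2 => by rw [hO ω ω' e l h1 h2]
  have hxor : ∀ {a b c : ℕ}, a ^^^ b = a ^^^ c → b = c := fun e => Nat.xor_right_inj.mp e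
  have hxor' : ∀ {a b c : ℕ}, a ^^^ c = b ^^^ c → a = b := fun e => Nat.xor_left_inj.mp e
  have i1 : mutualInfo W Y ≤ mutualInfo W (fun ω => (O ω, Y ω, S ω)) :=
    mutualInfo_mono_right W fun ω ω' e => by simp only [Prod.mk.injEq] at e; exact e.2.1
  -- the terms that involve the received sequence
  have i2 : entropy (fun ω => (O ω, Y ω, S ω)) ≤ entropy (fun ω => (O ω, S ω, Q ω)) := by
    refine entropy_mono fun ω ω' e => ?_
    simp only [Prod.mk.injEq] at e ⊢
    obtain ⟨e1, e2, e3⟩ := e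
    refine ⟨e1, funext fun t => ?_, e2⟩
    rw [hY, hY, hρ ω ω' e1]
    congr 1
    -- By the TIN condition the interference from `j` stays below the top `edgeWeight n i k` levels,
    -- so these carry exactly `S`.
    have hD : ∀ ω, D ω t / 2 ^ (n k k - edgeWeight n i k) = S ω t := fun ω => by
      simp only [D, S]
      rw [xor_div_two_pow, floor_two_pow_mul_div (by omega), Nat.div_eq_of_lt, Nat.xor_zero]
      · rfl
      · exact (floor_two_pow_mul_lt (hx j (ω j) t)).trans_le
          (Nat.pow_le_pow_right two_pos (by omega))
    rw [← Nat.div_add_mod (D ω t) (2 ^ (n k k - edgeWeight n i k)),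
      ← Nat.div_add_mod (D ω' t) (2 ^ (n k k - edgeWeight n i k)), hD, hD, e2]
    congr 1
    exact congrFun e3 t
  have i3 : entropy (fun ω => (O ω, S ω, Q ω)) ≤ entropy O + (entropy S + entropy Q) :=
    (entropy_pair_le O fun ω => (S ω, Q ω)).trans (by linarith [entropy_pair_le S Q])
  have i4 : entropy Q ≤ N * ((n k k : ℝ) - edgeWeight n i k) := by
    refine (entropy_le_logb_card Q (s := Fintype.piFinset fun _ =>
      Finset.range (2 ^ (n k k - edgeWeight n i k))) fun ω => ?_).trans_eq ?_
    · rw [Fintype.mem_piFinset]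
      exact fun t => Finset.mem_range.mpr (Nat.mod_lt _ (by positivity))
    · rw [Fintype.card_piFinset_const, Finset.card_range]
      push_cast
      rw [Real.logb_pow, Real.logb_pow, Real.logb_self_eq_one (by norm_num), mul_one,
        Nat.cast_sub (by omega)]
  -- the terms that involve the interference
  have i5 : mutualInfo W (fun ω => (O ω, Y ω, S ω)) ≤
      entropy W + entropy (fun ω => (O ω, Y ω, S ω)) - entropy (fun ω => (W ω, O ω, A ω)) := by
    refine mutualInfo_le W fun ω ω' e1 e => ?_
    simp only [Prod.mk.injEq] at e ⊢
    obtain ⟨e2, e3, -⟩ := e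
    refine ⟨e1, e2, funext fun t => ?_⟩
    have e4 := congrFun e3 t
    rw [hY, hY, hρ ω ω' e2] at e4
    have e5 := hxor' e4
    simp only [D] at e5
    rw [show ω k = ω' k from e1] at e5
    exact hxor e5
  have i6 : entropy W + entropy O + entropy A ≤ entropy (fun ω => (W ω, O ω, A ω)) := by
    have hWO : entropy (fun ω => (W ω, O ω)) = entropy W + entropy O :=
      entropy_pair_of_coordinate k W O (fun ω ω' e => e) fun ω a => funext fun l => by
        simp [O, l.2.1]
    by_cases e : k = j
    -- For `k = j` the edge weight is `0` and inputs are below `1`, so `A` is constantly zero.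
    · have hA : entropy A ≤ 0 := by
        refine (entropy_le_logb_card A (s := {0}) fun ω => ?_).trans_eq (by simp)
        rw [Finset.mem_singleton]
        funext t
        simp [A, crossSignal, edgeWeight, e, Nat.floor_eq_zero, (hx j (ω j) t).2]
      have : entropy (fun ω => (W ω, O ω)) ≤ entropy (fun ω => (W ω, O ω, A ω)) :=
        entropy_mono fun ω ω' => by simp +contextual
      linarith
    · have hAWO : entropy (fun ω => (A ω, W ω, O ω)) = entropy A + entropy (fun ω => (W ω, O ω)) :=
        entropy_pair_of_coordinate j A (fun ω => (W ω, O ω))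
          (fun ω ω' e => by simp only [A, e]) fun ω a => by
            refine Prod.ext (by simp [W, e]) (funext fun l => ?_)
            simp [O, l.2.2]
      have : entropy (fun ω => (A ω, W ω, O ω)) ≤ entropy (fun ω => (W ω, O ω, A ω)) :=
        entropy_mono fun ω ω' => by simp +contextual
      linarith
  change mutualInfo W Y ≤ entropy S + _ - entropy A
  linarith

/-- The cycle bound for the mutual informations of independent inputs. -/
theorem sum_mutualInfo_le (h : TINCondition n) (x : ∀ i, Ω i → Fin N → ℝ)
    (hx : ∀ i w t, x i w t ∈ Set.Ico (0 : ℝ) 1) (p : UserCycle K) :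
    ∑ l, mutualInfo (fun ω : ∀ i, Ω i => ω (p.vertex l)) (receivedSeq n x (p.vertex l)) ≤
      N * (∑ l, (n (p.vertex l) (p.vertex l) : ℝ) - p.weight n) := by
  let v := p.vertex
  have hshift : ∀ f : Fin (p.len + 1) → ℝ, ∑ l, f (l + 1) = ∑ l, f l := fun f =>
    Equiv.sum_comp (Equiv.addRight 1) f
  -- Centring the terms at `l + 1` names the predecessor `l` without subtraction. The negative
  -- entropy at `l` is the positive one at `l + 1`, so they cancel cyclically.
  rw [← hshift]
  refine (Finset.sum_le_sum fun l _ => mutualInfo_receivedSeq_le h x hx (v l) (v (l + 1))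
    (v (l + 1 + 1))).trans_eq ?_
  rw [Finset.sum_sub_distrib, Finset.sum_add_distrib, ← Finset.mul_sum, Finset.sum_sub_distrib,
    hshift (fun l => entropy fun ω : ∀ i, Ω i => crossSignal n (v l) (v (l + 1))
      (x (v (l + 1)) (ω (v (l + 1))))), hshift (fun l => (n (v l) (v l) : ℝ)), UserCycle.weight]
  push_cast
  simp only [v]
  ring

end Converse

/-! ### Both regions satisfy the cycle bounds -/

section Inclusions

variable {K : ℕ} {n : Fin K → Fin K → ℕ}

theorem isClosed_cycleRegion (n : Fin K → Fin K → ℕ) : IsClosed (cycleRegion n) := by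
  simp only [cycleRegion, Set.ofPred_and, Set.ofPred_forall]
  refine IsClosed.inter (isClosed_iInter fun k => isClosed_le continuous_const (by fun_prop))
    (isClosed_iInter fun p => isClosed_le (by fun_prop) continuous_const)

theorem sum_tinRate_le (h : TINCondition n) (r : Fin K → ℕ) (p : UserCycle K) :
    ∑ l, tinRate n r (p.vertex l) ≤
      ∑ l, (n (p.vertex l) (p.vertex l) : ℝ) - p.weight n := by
  set L := maxLevel n with hL
  -- One time slot is a block of length `1` with independent inputs.
  let x : (i : Fin K) → Fin (2 ^ L) → Fin 1 → ℝ := fun i w _ => ((w : ℕ) : ℝ) / 2 ^ (L + r i)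
  have hx : ∀ i w t, x i w t ∈ Set.Ico (0 : ℝ) 1 := fun i w t => by
    refine ⟨by positivity, (div_lt_one (by positivity)).mpr ?_⟩
    exact_mod_cast w.isLt.trans_le (Nat.pow_le_pow_right two_pos (by omega))
  have hI : ∀ k, tinRate n r k = mutualInfo (fun ω : Bits K L => ω k) (receivedSeq n x k) :=
    fun k => mutualInfo_congr (tinInput_eq_iff L r k) fun ω ω' =>
      ⟨fun e => funext fun _ => e, fun e => congrFun e 0⟩
  have := sum_mutualInfo_le h x hx p
  rw [Nat.cast_one, one_mul] at this
  simpa only [hI] using this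

theorem tinRegion_subset_cycleRegion (h : TINCondition n) : tinRegion n ⊆ cycleRegion n := by
  refine closure_minimal ?_ (isClosed_cycleRegion n)
  rintro R ⟨hR, T, hT, r, hr⟩
  refine ⟨hR, fun p => (Finset.sum_le_sum fun l _ => hr (p.vertex l)).trans ?_⟩
  have hT' : (0 : ℝ) < T := by exact_mod_cast hT
  rw [← Finset.sum_div, Finset.sum_comm, div_le_iff₀ hT']
  refine (Finset.sum_le_sum fun t _ => sum_tinRate_le h (r t) p).trans_eq ?_
  rw [Finset.sum_const, nsmul_eq_mul, Finset.card_univ, Fintype.card_fin, mul_comm]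

theorem mul_le_logb_numMessages (N : ℕ) (R : ℝ) : N * R ≤ Real.logb 2 (numMessages N R) := by
  rw [Real.le_logb_iff_rpow_le (by norm_num) (by exact_mod_cast numMessages_pos N R)]
  exact Nat.le_ceil _

theorem logb_numMessages_le (N : ℕ) {R : ℝ} (hR : 0 ≤ R) :
    Real.logb 2 (numMessages N R) ≤ N * R + 1 := by
  rw [Real.logb_le_iff_le_rpow (by norm_num) (by exact_mod_cast numMessages_pos N R),
    Real.rpow_add two_pos, Real.rpow_one]
  -- For `y ≥ 1` rounding up at most doubles, which costs one bit.
  have h1 : (1 : ℝ) ≤ 2 ^ (N * R) := Real.one_le_rpow (by norm_num) (by positivity)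
  have h2 := Nat.ceil_lt_add_one (zero_le_one.trans h1)
  change ((⌈(2 : ℝ) ^ (N * R)⌉₊ : ℕ) : ℝ) ≤ _
  linarith

/-- The rates of a code of block length `N` satisfy the cycle bounds up to Fano's error terms. -/
theorem sum_rate_le_of_code (h : TINCondition n) {R : Fin K → ℝ} (hR : ∀ k, 0 ≤ R k) {N : ℕ}
    (c : Code K N fun i => numMessages N (R i)) (p : UserCycle K) :
    ∑ l, (N * R (p.vertex l) - 1 - c.errorProb n (p.vertex l) * (N * R (p.vertex l) + 1)) ≤
      N * (∑ l, (n (p.vertex l) (p.vertex l) : ℝ) - p.weight n) := by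
  have : ∀ i, Nonempty (Fin (numMessages N (R i))) := fun i => ⟨⟨0, numMessages_pos _ _⟩⟩
  refine le_trans (Finset.sum_le_sum fun l _ => ?_) (sum_mutualInfo_le h c.enc c.enc_mem p)
  set k := p.vertex l
  refine le_trans ?_ (entropy_sub_le_mutualInfo_of_decoder
    (fun w : (i : Fin K) → Fin (numMessages N (R i)) => w k) (receivedSeq n c.enc k) (c.dec k))
  have h1 := logb_card_le_entropy_coordinate (Ω := fun i => Fin (numMessages N (R i))) k
  rw [Fintype.card_fin] at h1
  have h2 := mul_le_logb_numMessages N (R k)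
  have h3 : 0 ≤ c.errorProb n k := by unfold Code.errorProb; positivity
  have h4 := mul_le_mul_of_nonneg_left (logb_numMessages_le N (hR k)) h3
  change _ ≤ entropy _ - 1 - c.errorProb n k * _
  linarith

theorem capacityRegion_subset_cycleRegion (h : TINCondition n) :
    capacityRegion n ⊆ cycleRegion n := by
  refine closure_minimal ?_ (isClosed_cycleRegion n)
  rintro R ⟨hR, c, hc⟩
  refine ⟨hR, fun p => ?_⟩
  -- This is the left side of `sum_rate_le_of_code` divided by `N`; the Fano terms vanish in the
  -- limit.
  have hlim : Filter.Tendsto (fun N : ℕ => ∑ l, (R (p.vertex l) - 1 / (N : ℝ) -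
      (c N).errorProb n (p.vertex l) * (R (p.vertex l) + 1 / (N : ℝ)))) Filter.atTop
      (nhds (∑ l, (R (p.vertex l) - 0 - 0 * (R (p.vertex l) + 0)))) := by
    have h0 := tendsto_one_div_atTop_nhds_zero_nat (𝕜 := ℝ)
    exact tendsto_finsetSum _ fun l _ => (tendsto_const_nhds.sub h0).sub
      ((hc (p.vertex l)).mul (tendsto_const_nhds.add h0))
  simp only [sub_zero, zero_mul] at hlim
  refine le_of_tendsto hlim ?_
  filter_upwards [Filter.eventually_gt_atTop 0] with N hN
  have hN' : (0 : ℝ) < N := by exact_mod_cast hN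
  refine le_of_mul_le_mul_left (le_trans (le_of_eq ?_) (sum_rate_le_of_code h hR (c N) p)) hN'
  rw [Finset.mul_sum]
  refine Finset.sum_congr rfl fun l _ => ?_
  field_simp

end Inclusions

end ADT

theorem theorem2 (K : ℕ) (n : Fin K → Fin K → ℕ) (h : ADT.TINCondition n) :
    ADT.tinRegion n = ADT.capacityRegion n ∧ ADT.capacityRegion n = ADT.cycleRegion n := by
  have h1 : ADT.tinRegion n = ADT.cycleRegion n :=
    (ADT.tinRegion_subset_cycleRegion h).antisymm ADT.cycleRegion_subset_tinRegion
  have h2 : ADT.capacityRegion n = ADT.cycleRegion n :=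
    (ADT.capacityRegion_subset_cycleRegion h).antisymm ADT.cycleRegion_subset_capacityRegion
  exact ⟨h1.trans h2.symm, h2⟩
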